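/- Let $G=(V,E)$ be a finite connected simple graph. A configuration is a map $x:V\to\{0,1\}$. The majority dynamics started at $x^0=x$ is defined by \[ x^{t+1}_u=\begin{cases}1 & \text{if } \sum_{v\in N(u)}x^t_v>\tfrac{d(u)}2,\\ x^t_u & \text{if } \sum_{v\in N(u)}x^t_v=\tfrac{d(u)}2,\\ 0 & \text{otherwise.}\end{cases} \] The prediction problem is the language of all $(G,(x,y,T))$, with $x,y$ configurations of $G$ and $T>0$ an integer, such that $x^T=y$; the input of a node $v$ is $(x_v,y_v,T)$. The nodes of an $n$-node graph carry distinct identifiers in $\{1,\dots,n^c\}$, where $c>1$ is a fixed real constant. A locally checkable proof for this language on a class of graphs, with certificates of $s(n)$ bits, consists of a constant $t$ and a verifier, i.e. an arbitrary accept/reject rule that each node $v$ applies to the subgraph induced by the nodes at distance at most $t$ from $v$, including their identifiers, inputs and certificates, such that for all $n$-node graphs of the class and all identifier assignments: - (completeness) if $(G,(x,y,T))$ is in the language, there are certificates, i.e. one bit string of length at most $s(n)$ for each node, with which all nodes accept; the certificates may depend on the identifiers; - (soundness) if $(G,(x,y,T))$ is not in the language, then for every assignment of bit strings to the nodes at least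 one node rejects. **Theorem.** Every locally checkable proof for the prediction problem on connected $n$-node graphs of maximum degree at most $2$ (paths and cycles) has certificates of $\Omega(\log n)$ bits: for every $c>1$ and every such scheme with certificates of $s(n)$ bits there are $C>0$ and $n_0$ such that $s(n)\ge C\log n$ for all $n\ge n_0$. -/

import Mathlib

namespace MajorityCert

/-! ### Majority dynamics -/

section Dynamics

variable {V : Type*} [Fintype V]

open Classical in
/-- One synchronous step of the majority dynamics on `G`: `u` takes opinion `1` (`true`) if more
than half of its neighbours have opinion `1`, keeps its opinion if exactly half of them do, and
takes opinion `0` (`false`) otherwise. -/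
noncomputable def majorityStep (G : SimpleGraph V) (x : V → Bool) (u : V) : Bool :=
  if G.degree u < 2 * ((G.neighborFinset u).filter fun v => x v = true).card then true
  else if 2 * ((G.neighborFinset u).filter fun v => x v = true).card = G.degree u then x u
  else false

/-- The configuration `x ^ t` reached from `x` after `t` steps of the majority dynamics. -/
noncomputable def orbit (G : SimpleGraph V) (x : V → Bool) (t : ℕ) : V → Bool :=
  (majorityStep G)^[t] x

end Dynamics

/-! ### Locally checkable proofs -/

/-- What a node sees. Nodes are named by their identifiers: `center` is the node's own identifier,
`nodes` holds the visible nodes, each with its label, and `edges` the visible edges (both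
orientations). -/
structure View (A : Type*) where
  center : ℕ
  nodes : Set (ℕ × A)
  edges : Set (ℕ × ℕ)

/-- The radius-`t` view of `v`: the subgraph of `G` induced by the nodes at distance at most `t`
from `v`, with their identifiers and labels. -/
def viewAt {V A : Type*} (G : SimpleGraph V) (ident : V → ℕ) (label : V → A) (t : ℕ) (v : V) :
    View A where
  center := ident v
  nodes := {p | ∃ u, G.edist v u ≤ t ∧ p = (ident u, label u)}
  edges := {p | ∃ u w, G.edist v u ≤ t ∧ G.edist v w ≤ t ∧ G.Adj u w ∧ p = (ident u, ident w)}

/-- `ident` is an admissible identifier assignment on an `n`-node graph: it is injective with values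
in `{1, …, n ^ c}`. -/
def ValidIdent (c : ℝ) {n : ℕ} (ident : Fin n → ℕ) : Prop :=
  Function.Injective ident ∧ ∀ v, 1 ≤ ident v ∧ (ident v : ℝ) ≤ (n : ℝ) ^ c

/-- A property of graphs on `n` nodes, `n = 0, 1, …`, with an input in `I` at every node. -/
abbrev InputProperty (I : Type*) := ∀ n : ℕ, SimpleGraph (Fin n) → (Fin n → I) → Prop

/-- All nodes accept: the verifier, run on the radius-`t` view of each node, in which every node is
labelled by its input and its certificate, says yes. -/
def AllAccept {I : Type*} {n : ℕ} (t : ℕ) (verifier : View (I × List Bool) → Prop)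
    (G : SimpleGraph (Fin n)) (ident : Fin n → ℕ) (input : Fin n → I)
    (cert : Fin n → List Bool) : Prop :=
  ∀ v, verifier (viewAt G ident (fun u => (input u, cert u)) t v)

/-- `verifier`, run for `t` rounds, is the verifier of a locally checkable proof for the language
`lang` restricted to the instances in `dom`, with identifiers in `{1, …, n ^ c}` and with
certificates of at most `s n` bits on `n`-node graphs. -/
structure IsLocallyCheckableProof {I : Type*} (c : ℝ) (dom lang : InputProperty I) (t : ℕ)
    (verifier : View (I × List Bool) → Prop) (s : ℕ → ℕ) : Prop where
  /-- On a yes-instance the prover has certificates of at most `s n` bits, which may depend on the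
  identifiers, that make all nodes accept. -/
  complete : ∀ (n : ℕ) (G : SimpleGraph (Fin n)) (input : Fin n → I) (ident : Fin n → ℕ),
    ValidIdent c ident → dom n G input → lang n G input →
      ∃ cert : Fin n → List Bool, (∀ v, (cert v).length ≤ s n) ∧
        AllAccept t verifier G ident input cert
  /-- On a no-instance, whatever the certificates, some node rejects. -/
  sound : ∀ (n : ℕ) (G : SimpleGraph (Fin n)) (input : Fin n → I) (ident : Fin n → ℕ),
    ValidIdent c ident → dom n G input → ¬ lang n G input →
      ∀ cert : Fin n → List Bool, ¬ AllAccept t verifier G ident input cert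

/-! ### The prediction problem on paths and cycles -/

/-- Input of a node `v`: its opinion `x v` in the initial configuration, its opinion `y v` in the
target configuration, and the number `T` of time-steps (the same at all nodes). -/
abbrev PredictionInput := Bool × Bool × ℕ

/-- The local inputs that represent the global input `(x, y, T)`. -/
def predictionInput {n : ℕ} (x y : Fin n → Bool) (T : ℕ) (v : Fin n) : PredictionInput :=
  (x v, y v, T)

/-- The language `{(G, (x, y, T)) : T > 0 and x ^ T = y}`. -/
def ElectionPred : InputProperty PredictionInput := fun _ G input =>
  ∃ x y T, input = predictionInput x y T ∧ 0 < T ∧ orbit G x T = y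

open Classical in
/-- The instances `(G, (x, y, T))` in which `G` is connected of maximum degree at most `2`. -/
def MaxDegreeTwoInstance : InputProperty PredictionInput := fun _ G input =>
  G.Connected ∧ (∀ v, G.degree v ≤ 2) ∧ ∃ x y T, input = predictionInput x y T

end MajorityCert

/-! A fooling set argument on the path. An alternating region `1010…` with zeros to its left recedes
one position per step, so its initial front `q` determines the front `q + T` at time `T`. Take `K`
even fronts `q ≤ 2K` and `T = 2K + 2t`. On the window `[2K, 2K + 2t)` all these instances look
alike: initially the front has started and the parity is the same, finally it lies further right. If
two of them had equal certificates there, `allAccept_glue` would make all nodes accept the start of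
one with the target of the other, a no-instance. So the window's certificates take at least `K`
values (`le_three_pow`), and `K = n / 8` gives the logarithm. -/

namespace MajorityCert

open SimpleGraph

section Dynamics

variable {V : Type*} [Fintype V] {G : SimpleGraph V} {u a b : V}

/-- A node of degree `1` copies its neighbour. -/
theorem majorityStep_of_adj_iff_eq (h : ∀ w, G.Adj u w ↔ w = a) (x : V → Bool) :
    majorityStep G x u = x a := by
  classical
  unfold majorityStep
  rw [← card_neighborFinset_eq_degree]
  have hN : G.neighborFinset u = {a} := by ext w; simp [h]
  cases hx : x a <;> simp [hN, Finset.filter_singleton, hx]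

/-- A node of degree `2` adopts the opinion of its neighbours if they agree, and keeps its own
otherwise. -/
theorem majorityStep_of_adj_iff_or (hab : a ≠ b) (h : ∀ w, G.Adj u w ↔ w = a ∨ w = b)
    (x : V → Bool) :
    majorityStep G x u = if x a = x b then x a else x u := by
  classical
  unfold majorityStep
  rw [← card_neighborFinset_eq_degree]
  have hN : G.neighborFinset u = {a, b} := by ext w; simp [h]
  cases hx : x a <;> cases hy : x b <;>
    simp [hN, Finset.filter_insert, Finset.filter_singleton, hx, hy, hab]

end Dynamics

section Path

variable {n : ℕ}

theorem pathGraph_val_le_of_walk {u v : Fin n} (w : (pathGraph n).Walk u v) :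
    (u : ℕ) ≤ v + w.length ∧ (v : ℕ) ≤ u + w.length := by
  induction w with
  | nil => simp
  | cons h _ ih =>
    rw [pathGraph_adj] at h
    rw [Walk.length_cons]
    omega

theorem pathGraph_val_le_of_edist_le {u v : Fin n} {t : ℕ} (h : (pathGraph n).edist u v ≤ t) :
    (u : ℕ) ≤ v + t ∧ (v : ℕ) ≤ u + t := by
  obtain ⟨w, hw⟩ := exists_walk_of_edist_ne_top
    (ne_top_of_le_ne_top (ENat.natCast_ne_top t) h)
  have hl : w.length ≤ t := by exact_mod_cast hw.trans_le h
  have := pathGraph_val_le_of_walk w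
  omega

theorem pathGraph_degree_le_two (u : Fin n) [Fintype ((pathGraph n).neighborSet u)] :
    (pathGraph n).degree u ≤ 2 := by
  rw [← card_neighborFinset_eq_degree,
    ← Finset.card_image_of_injective _ Fin.val_injective]
  refine (Finset.card_le_card (t := {(u : ℕ) + 1, (u : ℕ) - 1}) fun i hi => ?_).trans
    Finset.card_le_two
  obtain ⟨v, hv, rfl⟩ := Finset.mem_image.1 hi
  rw [mem_neighborFinset, pathGraph_adj] at hv
  simp only [Finset.mem_insert, Finset.mem_singleton]
  omega

/-- The configuration of the path that is `0` before position `q` and `1010…` from there on. -/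
def frontConfig (n q : ℕ) (i : Fin n) : Bool := decide (q ≤ i ∧ Even ((i : ℕ) + q))

/-- The front of the alternating region moves by one position in each step. -/
theorem majorityStep_frontConfig {q : ℕ} (hn : 2 ≤ n) (hq : 2 ≤ q) :
    majorityStep (pathGraph n) (frontConfig n q) = frontConfig n (q + 1) := by
  funext u
  obtain ⟨i, hi⟩ := u
  rcases Nat.eq_zero_or_pos i with rfl | hpos
  -- The left end copies position `1`, which is `0` because `2 ≤ q`; for `q = 1` it would turn to
  -- `1`.
  · rw [majorityStep_of_adj_iff_eq (a := ⟨1, hn⟩) fun w => by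
      rw [pathGraph_adj, Fin.ext_iff]; dsimp only; omega]
    simp only [frontConfig, decide_eq_decide]
    omega
  by_cases hlast : i + 1 < n
  · rw [majorityStep_of_adj_iff_or (a := ⟨i - 1, by omega⟩) (b := ⟨i + 1, hlast⟩)
      (by rw [Ne, Fin.ext_iff]; dsimp only; omega) fun w => by
        rw [pathGraph_adj, Fin.ext_iff, Fin.ext_iff]; dsimp only; omega]
    simp only [frontConfig, decide_eq_decide, Nat.even_iff]
    split_ifs <;> simp only [decide_eq_decide] <;> omega
  · rw [majorityStep_of_adj_iff_eq (a := ⟨i - 1, by omega⟩) fun w => by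
      rw [pathGraph_adj, Fin.ext_iff]; dsimp only; omega]
    simp only [frontConfig, decide_eq_decide, Nat.even_iff]
    omega

theorem orbit_frontConfig {q : ℕ} (hn : 2 ≤ n) (hq : 2 ≤ q) (T : ℕ) :
    orbit (pathGraph n) (frontConfig n q) T = frontConfig n (q + T) := by
  induction T with
  | zero => rfl
  | succ T ih =>
    rw [orbit, Function.iterate_succ_apply']
    change majorityStep _ (orbit _ _ T) = _
    rw [ih, majorityStep_frontConfig hn (by omega), add_assoc]

theorem frontConfig_ne {p q : ℕ} (hp : p < n) (hpq : p < q) :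
    frontConfig n p ≠ frontConfig n q := by
  intro h
  have := congrFun h ⟨p, hp⟩
  simp [frontConfig, hpq.not_ge] at this

end Path

theorem viewAt_congr {V A : Type*} {G : SimpleGraph V} {ident : V → ℕ} {l l' : V → A} {t : ℕ}
    {v : V} (h : ∀ u, G.edist v u ≤ t → l u = l' u) :
    viewAt G ident l t v = viewAt G ident l' t v := by
  unfold viewAt
  congr 1
  ext p
  refine exists_congr fun u => and_congr_right fun hu => ?_
  rw [h u hu]

/-- The local inputs determine the global one; reading off `T` needs a node, hence `0 < n`. -/
theorem electionPred_predictionInput {n : ℕ} (hn : 0 < n) {G : SimpleGraph (Fin n)}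
    {x y : Fin n → Bool} {T : ℕ} (h : ElectionPred n G (predictionInput x y T)) :
    orbit G x T = y := by
  obtain ⟨x', y', T', he, -, ho⟩ := h
  have hv v : x v = x' v ∧ y v = y' v ∧ T = T' := by
    simpa [predictionInput] using congrFun he v
  obtain rfl : x = x' := funext fun v => (hv v).1
  obtain rfl : y = y' := funext fun v => (hv v).2.1
  obtain rfl := (hv ⟨0, hn⟩).2.2
  exact ho

theorem validIdent_succ {c : ℝ} (hc : 1 ≤ c) {n : ℕ} :
    ValidIdent c fun v : Fin n => (v : ℕ) + 1 := by
  refine ⟨fun u v h => Fin.ext (Nat.succ_injective h), fun v => ⟨Nat.succ_pos _, ?_⟩⟩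
  have hn : (1 : ℝ) ≤ n := by exact_mod_cast v.pos
  calc (((v : ℕ) + 1 : ℕ) : ℝ) ≤ n := by exact_mod_cast v.isLt
    _ = (n : ℝ) ^ (1 : ℝ) := (Real.rpow_one _).symm
    _ ≤ (n : ℝ) ^ c := Real.rpow_le_rpow_of_exponent_le hn hc

theorem maxDegreeTwoInstance_pathGraph {n : ℕ} (hn : 0 < n) (x y : Fin n → Bool) (T : ℕ) :
    MaxDegreeTwoInstance n (pathGraph n) (predictionInput x y T) := by
  classical
  refine ⟨?_, fun v => pathGraph_degree_le_two v, x, y, T, rfl⟩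
  obtain ⟨m, rfl⟩ := Nat.exists_eq_succ_of_ne_zero hn.ne'
  exact pathGraph_connected m

/-- If two instances on the path agree on the positions in `[m - t, m + t)`, then a verifier that
accepts both accepts the instance glued from the left part of one and the right part of the
other. -/
theorem allAccept_glue {I : Type*} {n t m : ℕ} {verifier : View (I × List Bool) → Prop}
    {ident : Fin n → ℕ} {input input₁ input₂ : Fin n → I} {cert₁ cert₂ : Fin n → List Bool}
    (h₁ : AllAccept t verifier (pathGraph n) ident input₁ cert₁)
    (h₂ : AllAccept t verifier (pathGraph n) ident input₂ cert₂)
    (hi₁ : ∀ v : Fin n, (v : ℕ) < m + t → input v = input₁ v)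
    (hi₂ : ∀ v : Fin n, m ≤ v + t → input v = input₂ v)
    (hcert : ∀ v : Fin n, m ≤ v + t → (v : ℕ) < m + t → cert₁ v = cert₂ v) :
    AllAccept t verifier (pathGraph n) ident input
      (fun v => if (v : ℕ) < m then cert₁ v else cert₂ v) := by
  intro v
  by_cases hv : (v : ℕ) < m
  · rw [viewAt_congr (l' := fun u => (input₁ u, cert₁ u))]
    · exact h₁ v
    · intro u hu
      have := pathGraph_val_le_of_edist_le hu
      refine Prod.ext (hi₁ u (by omega)) ?_
      dsimp only
      split_ifs with hum
      · rfl
      · exact (hcert u (by omega) (by omega)).symm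
  · rw [viewAt_congr (l' := fun u => (input₂ u, cert₂ u))]
    · exact h₂ v
    · intro u hu
      have := pathGraph_val_le_of_edist_le hu
      refine Prod.ext (hi₂ u (by omega)) ?_
      dsimp only
      split_ifs with hum
      · exact hcert u (by omega) (by omega)
      · rfl

/-- A list of length at most `s` is determined by its first `s` optional entries. -/
theorem list_eq_of_forall_getElem? {α : Type*} {s : ℕ} {l l' : List α} (hl : l.length ≤ s)
    (hl' : l'.length ≤ s) (h : ∀ i : Fin s, l[(i : ℕ)]? = l'[(i : ℕ)]?) : l = l' := by
  refine List.ext_getElem? fun i => ?_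
  by_cases hi : i < s
  · exact h ⟨i, hi⟩
  · rw [List.getElem?_eq_none (by omega), List.getElem?_eq_none (by omega)]

/-- The fooling set bound: certificates on a window of `2 * t` nodes distinguish the `K` instances
in which the front starts at position `2`, `4`, …, `2 * K`. -/
theorem IsLocallyCheckableProof.le_three_pow {c : ℝ} (hc : 1 ≤ c) {t : ℕ}
    {verifier : View (PredictionInput × List Bool) → Prop} {s : ℕ → ℕ}
    (h : IsLocallyCheckableProof c MaxDegreeTwoInstance ElectionPred t verifier s)
    {n K : ℕ} (hK : 0 < K) (hn : 4 * K + 2 * t < n) : K ≤ (3 ^ s n) ^ (2 * t) := by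
  have hn0 : 0 < n := by omega
  let T := 2 * K + 2 * t
  let pos (k : Fin K) : ℕ := 2 * k + 2
  let input (p q : Fin K) : Fin n → PredictionInput :=
    predictionInput (frontConfig n (pos p)) (frontConfig n (pos q + T)) T
  have horbit (p : Fin K) :
      orbit (pathGraph n) (frontConfig n (pos p)) T = frontConfig n (pos p + T) :=
    orbit_frontConfig (by omega) (by simp [pos]) T
  have hyes (p : Fin K) := h.complete n (pathGraph n) (input p p) _ (validIdent_succ hc)
    (maxDegreeTwoInstance_pathGraph hn0 _ _ _)
    ⟨_, _, _, rfl, by simp only [T]; omega, horbit p⟩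
  choose cert hlen hacc using hyes
  -- Padding with `none` gives three values per entry, hence the base `3`.
  let code (p : Fin K) (j : Fin (2 * t)) (i : Fin (s n)) : Option Bool :=
    (cert p ⟨2 * K + j, by omega⟩)[(i : ℕ)]?
  suffices hinj : Function.Injective code by
    simpa using Fintype.card_le_of_injective code hinj
  refine Function.Injective.of_lt_imp_ne fun p q hpq hcode => ?_
  have hno : ¬ ElectionPred n (pathGraph n) (input p q) := fun hyes => by
    have := electionPred_predictionInput hn0 hyes
    rw [horbit p] at this
    exact frontConfig_ne (by simp only [pos, T]; omega) (by simp only [pos, T]; omega) this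
  refine h.sound n (pathGraph n) (input p q) _ (validIdent_succ hc)
    (maxDegreeTwoInstance_pathGraph hn0 _ _ _) hno _
    (allAccept_glue (m := 2 * K + t) (hacc p) (hacc q) ?_ ?_ ?_)
  -- Left of `2K + 2t = T` both targets are still `0`.
  · intro v hv
    simp only [input, predictionInput, frontConfig, Prod.mk.injEq, decide_eq_decide, pos, T,
      true_and, and_true]
    omega
  -- From `2K` on both starts alternate, in phase since the fronts are even.
  · intro v hv
    simp only [input, predictionInput, frontConfig, Prod.mk.injEq, decide_eq_decide, pos,
      and_true, Nat.even_iff]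
    omega
  · intro v hv hv'
    refine list_eq_of_forall_getElem? (hlen p v) (hlen q v) fun i => ?_
    have := congrFun (congrFun hcode ⟨v - 2 * K, by omega⟩) i
    have hv2 : 2 * K + ((v : ℕ) - 2 * K) = v := by omega
    simpa only [code, hv2] using this

end MajorityCert

/-- Every locally checkable proof for predicting the majority dynamics on connected `n`-node graphs
of maximum degree at most `2` has certificates of `Ω(log n)` bits. -/
theorem mainTheorem5 (c : ℝ) (hc : 1 < c) (t : ℕ)
    (verifier : MajorityCert.View (MajorityCert.PredictionInput × List Bool) → Prop) (s : ℕ → ℕ)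
    (h : MajorityCert.IsLocallyCheckableProof c MajorityCert.MaxDegreeTwoInstance
      MajorityCert.ElectionPred t verifier s) :
    ∃ C : ℝ, 0 < C ∧ ∃ n₀ : ℕ, ∀ n : ℕ, n₀ ≤ n → C * Real.log n ≤ (s n : ℝ) := by
  -- The `+ 1` covers `t = 0`. The term `4 * t` makes the path long enough for `K = n / 8`, and `72`
  -- gives `9 ≤ n / 8`, whence `n ≤ (n / 8) ^ 2`.
  refine ⟨1 / (8 * t + 1), by positivity, 4 * t + 72, fun n hn => ?_⟩
  have hK := h.le_three_pow hc.le (n := n) (K := n / 8) (by omega) (by omega)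
  have hsq : n ≤ (n / 8) ^ 2 := by
    have h9 : 9 ≤ n / 8 := by omega
    have h8 : n < 8 * (n / 8) + 8 := by omega
    nlinarith
  have hpow : n ≤ 3 ^ (4 * t * s n) := by
    calc n ≤ (n / 8) ^ 2 := hsq
      _ ≤ ((3 ^ s n) ^ (2 * t)) ^ 2 := Nat.pow_le_pow_left hK 2
      _ = 3 ^ (4 * t * s n) := by rw [← pow_mul, ← pow_mul]; congr 1; ring
  have hlog3 : Real.log 3 ≤ 2 := by
    have := Real.log_le_sub_one_of_pos (x := 3) (by norm_num)
    linarith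
  have hlog : Real.log n ≤ 4 * t * s n * Real.log 3 := by
    have hn0 : (0 : ℝ) < n := by exact_mod_cast (by omega : 0 < n)
    have := Real.log_le_log hn0 (y := (3 : ℝ) ^ (4 * t * s n)) (by exact_mod_cast hpow)
    rwa [Real.log_pow, Nat.cast_mul, Nat.cast_mul, Nat.cast_ofNat] at this
  rw [one_div_mul_eq_div, div_le_iff₀ (by positivity)]
  calc Real.log n ≤ 4 * t * s n * Real.log 3 := hlog
    _ ≤ 4 * t * s n * 2 := by gcongr
    _ ≤ s n * (8 * t + 1) := by nlinarith [(s n).cast_nonneg (α := ℝ)]
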